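/- Graphs are finite and may have loops and parallel edges; a graph is $2$-edge-connected if for every nonempty proper subset $X$ of its vertex set at least two edges have exactly one end in $X$. Fix an orientation of the edges of a graph $G$. A $\mathbb{Z}_2\times\mathbb{Z}_3$-flow on $G$ is a map $\varphi : E(G)\to \mathbb{Z}_2\times\mathbb{Z}_3$ such that $\sum_{e\in\delta^+(v)}\varphi(e)=\sum_{e\in\delta^-(v)}\varphi(e)$ for every vertex $v$, where $\delta^+(v)$ and $\delta^-(v)$ are the sets of edges directed away from and towards $v$; it is nowhere-zero if $\varphi(e)\neq 0$ for every edge $e$. (The number of nowhere-zero flows does not depend on the orientation.) Every $2$-edge-connected graph with $n$ vertices and $m$ edges has at least $2^{2(m-n)/9}$ nowhere-zero $\mathbb{Z}_2\times\mathbb{Z}_3$-flows. The bound is optimal up to the constant in the exponent: for all integers $n$ and $m$ with $n\le m<2n$ there is a $2$-edge-connected graph with $n$ vertices and $m$ edges that has exactly $5\cdot 2^{2(m-n)}$ nowhere-zero $\mathbb{Z}_2\times\mathbb{Z}_3$-flows. -/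

import Mathlib

namespace Graph

variable {α β : Type*}

/-- The edges of `G` with exactly one end in `X` (`X` is a set of vertices of `G`). -/
def edgeCut (G : Graph α β) (X : Set α) : Set β :=
  {e | ∃ x y, G.IsLink e x y ∧ x ∈ X ∧ y ∉ X}

/-- A graph is `k`-edge-connected if every nonempty proper subset of its vertex set is left by at
least `k` edges. Loops and parallel edges are allowed; one-vertex graphs qualify. -/
def IsEdgeConnected (G : Graph α β) (k : ℕ) : Prop :=
  ∀ X : Set α, X ⊆ V(G) → X.Nonempty → X ≠ V(G) → (k : ℕ∞) ≤ (G.edgeCut X).encard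

/-- An orientation of `G`: every edge is directed from one of its ends, `tail e`, to the
other one, `head e` (for a loop the two coincide). -/
structure Orientation (G : Graph α β) where
  tail : E(G) → α
  head : E(G) → α
  isLink : ∀ e : E(G), G.IsLink e (tail e) (head e)

namespace Orientation

variable {G : Graph α β}

/-- The set `δ⁺(v)` of edges directed away from `v`. -/
def outEdges (D : G.Orientation) (v : α) : Set E(G) := {e | D.tail e = v}

/-- The set `δ⁻(v)` of edges directed towards `v`. -/
def inEdges (D : G.Orientation) (v : α) : Set E(G) := {e | D.head e = v}

/-- Kirchhoff's law at every vertex, for a graph with finitely many edges. -/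
def IsFlow {Γ : Type*} [AddCommGroup Γ] (D : G.Orientation) (φ : E(G) → Γ) : Prop :=
  ∀ v ∈ V(G), ∑ᶠ e ∈ D.outEdges v, φ e = ∑ᶠ e ∈ D.inEdges v, φ e

/-- The set of nowhere-zero `Γ`-flows of the graph `G` with orientation `D`. -/
def nowhereZeroFlows (D : G.Orientation) (Γ : Type*) [AddCommGroup Γ] : Set (E(G) → Γ) :=
  {φ | D.IsFlow φ ∧ ∀ e, φ e ≠ 0}

end Orientation

end Graph

/-!
# Many nowhere-zero flows over `ZMod 2 × ZMod 3`

Lower bound. A `2`-edge cut forces its two edges to carry the same value up to sign, so contracting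
one of them loses no nowhere-zero flow of the contraction and keeps `m - n`
(`FlowCount.EdgeConnected.two_rpow_le`). This leaves `3`-edge-connected graphs. For these, a
quantitative form of Seymour's proof of the `6`-flow theorem (`FlowCount.exists_flow_zeros_le`)
gives an even subgraph `C` and a `ZMod 3`-flow `ψ` whose zero set `Z` lies in `C` and satisfies
`3 * #Z ≤ #C`. As all degrees are at least three, every even subgraph has at most `2 * (m - n)`
edges (`FlowCount.card_add_le_of_even`), so `#Z ≤ 2 * (m - n) / 3`. Every `ZMod 2`-flow vanishing
on `Z`, added to the indicator of `C` and paired with `ψ`, gives a nowhere-zero flow, and there are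
at least `2 ^ (m - n - #Z)` of them (`FlowCount.two_pow_card_le`). This yields the exponent
`(m - n) / 3`, which is at least `2 * (m - n) / 9` when `n ≤ m`. A graph with at most one vertex
needs no trail at all: there `ψ = 1` and `C = ∅` will do.

The subgraph `C` grows by closed trails. Let `U` be spanned by what has been built. Among the sets
outside `U` that at most one edge of the graph minus `U` leaves, a minimal one, `B`, sends at least
two edges to `U` and induces a `2`-edge-connected graph, so a closed trail in `B` meets both edges
(`FlowCount.exists_ear`). A multiple of a flow through the two edges avoids any two prescribed
values on them, and some multiple of the flow along the trail vanishes on at most a third of the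
trail once everything is added up (`FlowCount.IsAvoiding.extend`). Paths and trails are handled as
integral flows with values in `{-1, 0, 1}`.

Tightness. In a cycle with `m - n < n` edges doubled, some edge is not doubled, so the value `c`
that goes around the cycle is one of `5` nonzero elements, and each pair of parallel edges splits
`c` into two nonzero values in `4` ways (`FlowCount.ncard_nzFlows_cycle`).
-/

/-! ### Boundaries, flows and cuts -/

namespace FlowCount

variable {V E A : Type*} [Fintype E] [DecidableEq V] [AddCommGroup A]

/-- The boundary of `φ : E → A` for the digraph in which the edge `e` goes from `s e` to `t e`:
its value at a vertex is outflow minus inflow. The flows are the `φ` with boundary `0`. -/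
def boundary (s t : E → V) : (E → A) →+ (V → A) where
  toFun φ v := ∑ e, ((if s e = v then φ e else 0) - (if t e = v then φ e else 0))
  map_zero' := by ext; simp
  map_add' φ ψ := by
    ext v
    simp only [Pi.add_apply, ← Finset.sum_add_distrib]
    refine Finset.sum_congr rfl fun e _ => ?_
    split_ifs <;> abel

/-- The nowhere-zero `Γ`-flows. -/
def nzFlows (s t : E → V) (Γ : Type*) [AddCommGroup Γ] : Set (E → Γ) :=
  {φ | boundary s t φ = 0 ∧ ∀ e, φ e ≠ 0}

/-- The edges with exactly one end in `X`. -/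
def cut (s t : E → V) (X : Finset V) : Finset E := {e | ¬(s e ∈ X ↔ t e ∈ X)}

/-- Every nonempty proper set of vertices is left by at least `k` edges. -/
def EdgeConnected [Fintype V] (s t : E → V) (k : ℕ) : Prop :=
  ∀ X : Finset V, X.Nonempty → X ≠ Finset.univ → k ≤ (cut s t X).card

variable (s t : E → V)

lemma boundary_apply (φ : E → A) (v : V) : boundary s t φ v =
    ∑ e, ((if s e = v then φ e else 0) - (if t e = v then φ e else 0)) := rfl

lemma mem_cut {X : Finset V} {e : E} : e ∈ cut s t X ↔ ¬(s e ∈ X ↔ t e ∈ X) := by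
  simp [cut]

lemma sum_boundary (φ : E → A) (X : Finset V) : ∑ v ∈ X, boundary s t φ v =
    ∑ e, ((if s e ∈ X then φ e else 0) - (if t e ∈ X then φ e else 0)) := by
  simp only [boundary_apply]
  rw [Finset.sum_comm]
  refine Finset.sum_congr rfl fun e _ => ?_
  simp [Finset.sum_sub_distrib]

lemma boundary_map {B : Type*} [AddCommGroup B] (f : A →+ B) (φ : E → A) :
    boundary s t (fun e => f (φ e)) = fun v => f (boundary s t φ v) := by
  ext v
  simp only [boundary_apply, map_sum, map_sub]
  refine Finset.sum_congr rfl fun e _ => ?_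
  split_ifs <;> simp

lemma boundary_intCast {R : Type*} [Ring R] (φ : E → ℤ) :
    boundary s t (fun e => (φ e : R)) = fun v => ((boundary s t φ v : ℤ) : R) :=
  boundary_map s t (Int.castAddHom R) φ

lemma boundary_smul {R : Type*} [Ring R] (r : R) (φ : E → R) :
    boundary s t (r • φ) = r • boundary s t φ :=
  boundary_map s t (AddMonoidHom.mulLeft r) φ

lemma boundary_single [DecidableEq E] (e : E) (a : A) :
    boundary s t (Pi.single e a) = Pi.single (s e) a - Pi.single (t e) a := by
  ext v
  rw [boundary_apply, Finset.sum_eq_single e]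
  · simp [Pi.single_apply, eq_comm]
  · intro e' _ h
    simp [h]
  · simp

/-- Restricting a flow to a vertex set that none of its edges leaves gives a flow. -/
lemma boundary_restrict (φ : E → A) (S : Finset V)
    (hS : ∀ e, φ e ≠ 0 → (s e ∈ S ↔ t e ∈ S)) (hφ : boundary s t φ = 0) :
    boundary s t (fun e => if s e ∈ S then φ e else 0) = 0 := by
  ext v
  by_cases hv : v ∈ S
  · have h := congrFun hφ v
    rw [boundary_apply] at h ⊢
    rw [← h]
    refine Finset.sum_congr rfl fun e _ => ?_
    by_cases he : φ e = 0
    · simp [he]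
    · have := hS e he
      by_cases h1 : s e ∈ S
      · simp [h1]
      · have h2 : t e ∉ S := fun h => h1 (this.2 h)
        have h3 : s e ≠ v := fun h => h1 (h ▸ hv)
        have h4 : t e ≠ v := fun h => h2 (h ▸ hv)
        simp [h3, h4]
  · rw [boundary_apply]
    refine Finset.sum_eq_zero fun e _ => ?_
    by_cases he : φ e = 0
    · simp [he]
    · have := hS e he
      by_cases h1 : s e ∈ S
      · have h3 : s e ≠ v := fun h => hv (h ▸ h1)
        have h4 : t e ≠ v := fun h => hv (h ▸ this.1 h1)
        simp [h3, h4]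
      · simp [h1]

/-! ### Unit flows between two vertices -/

/-- `q` is an integral flow of value one from `x` to `y`. -/
def IsUnitFlow (q : E → ℤ) (x y : V) : Prop :=
  boundary s t q = Pi.single x 1 - Pi.single y 1

lemma IsUnitFlow.zero (x : V) : IsUnitFlow s t 0 x x := by simp [IsUnitFlow]

variable {s t}

lemma IsUnitFlow.add {p q : E → ℤ} {x y z : V} (hp : IsUnitFlow s t p x y)
    (hq : IsUnitFlow s t q y z) : IsUnitFlow s t (p + q) x z := by
  unfold IsUnitFlow at *
  rw [map_add, hp, hq]; abel

lemma IsUnitFlow.neg {p : E → ℤ} {x y : V} (hp : IsUnitFlow s t p x y) :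
    IsUnitFlow s t (-p) y x := by
  unfold IsUnitFlow at *
  rw [map_neg, hp]; abel

lemma IsUnitFlow.single [DecidableEq E] (e : E) :
    IsUnitFlow s t (Pi.single e 1) (s e) (t e) := boundary_single s t e 1

lemma IsUnitFlow.sum {p : E → ℤ} {x y : V} (hp : IsUnitFlow s t p x y) {S : Finset V}
    (hx : x ∈ S) (hy : y ∉ S) :
    ∑ e, ((if s e ∈ S then p e else 0) - (if t e ∈ S then p e else 0)) = 1 := by
  rw [← sum_boundary, hp]
  simp [Finset.sum_sub_distrib, Finset.sum_pi_single', hx, hy]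

/-- Growing a tree from `v` along edges that may be used forwards (`F`) or backwards (`B`): every
vertex reached is the end of a path, seen as a unit flow, and no usable edge leaves the set of
vertices reached. -/
lemma exists_reachable [Fintype V] (F B : E → Prop) (v : V) : ∃ S : Finset V, v ∈ S ∧
    (∀ x ∈ S, ∃ q : E → ℤ, IsUnitFlow s t q v x ∧
      (∀ e, q e = 0 ∨ (q e = 1 ∧ F e) ∨ (q e = -1 ∧ B e)) ∧
      ∀ e, q e ≠ 0 → s e ∈ S ∧ t e ∈ S) ∧
    (∀ e, F e → s e ∈ S → t e ∈ S) ∧ (∀ e, B e → t e ∈ S → s e ∈ S) := by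
  classical
  -- Paths are kept inside `S`, so that an edge leaving `S` is unused by the path to its end in `S`.
  let P : Finset V → Prop := fun S => v ∈ S ∧ ∀ x ∈ S, ∃ q : E → ℤ, IsUnitFlow s t q v x ∧
      (∀ e, q e = 0 ∨ (q e = 1 ∧ F e) ∨ (q e = -1 ∧ B e)) ∧
      ∀ e, q e ≠ 0 → s e ∈ S ∧ t e ∈ S
  have h0 : P {v} := ⟨by simp, fun x hx => ⟨0, by
    rw [Finset.mem_singleton.1 hx]; exact .zero s t v, by simp, by simp⟩⟩
  obtain ⟨S, hS, hmax⟩ := Finset.exists_max_image (Finset.univ.filter P) Finset.card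
    ⟨{v}, by simpa using h0⟩
  simp only [Finset.mem_filter, Finset.mem_univ, true_and] at hS hmax
  have hno : ∀ x y : V, ∀ r : E → ℤ, x ∈ S → y ∉ S → IsUnitFlow s t r x y →
      (∀ e, r e = 0 ∨ (((r e = 1 ∧ F e) ∨ (r e = -1 ∧ B e)) ∧
        ((s e = x ∧ t e = y) ∨ (s e = y ∧ t e = x)))) → False := by
    intro x y r hx hy hr hre
    have hP : P (insert y S) := by
      refine ⟨Finset.mem_insert_of_mem hS.1, fun z hz => ?_⟩
      rcases Finset.mem_insert.1 hz with rfl | hz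
      · obtain ⟨q, hq, hq1, hq2⟩ := hS.2 x hx
        have hdisj : ∀ e, r e ≠ 0 → q e = 0 := by
          intro e he
          by_contra hqe
          rcases (hre e).resolve_left he with ⟨_, h | h⟩
          · exact hy (h.2 ▸ (hq2 e hqe).2)
          · exact hy (h.1 ▸ (hq2 e hqe).1)
        refine ⟨q + r, hq.add hr, fun e => ?_, fun e he => ?_⟩
        · by_cases h : r e = 0
          · simpa [h] using hq1 e
          · simpa [hdisj e h] using Or.inr ((hre e).resolve_left h).1
        · by_cases h : r e = 0
          · have := hq2 e (by simpa [h] using he)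
            exact ⟨Finset.mem_insert_of_mem this.1, Finset.mem_insert_of_mem this.2⟩
          · rcases (hre e).resolve_left h with ⟨_, h | h⟩ <;> simp [h.1, h.2, hx]
      · obtain ⟨q, hq, hq1, hq2⟩ := hS.2 z hz
        exact ⟨q, hq, hq1, fun e he => ⟨Finset.mem_insert_of_mem (hq2 e he).1,
          Finset.mem_insert_of_mem (hq2 e he).2⟩⟩
    have := hmax _ hP
    rw [Finset.card_insert_of_notMem hy] at this
    omega
  refine ⟨S, hS.1, hS.2, fun e he hs => ?_, fun e he ht => ?_⟩
  · by_contra ht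
    refine hno _ _ _ hs ht (IsUnitFlow.single e) fun e' => ?_
    by_cases h : e' = e
    · subst h; simp [he]
    · simp [h]
  · by_contra hs
    refine hno _ _ _ ht hs (IsUnitFlow.single e).neg fun e' => ?_
    by_cases h : e' = e
    · subst h; simp [he]
    · simp [h]

/-- The edge form of Menger's theorem for two paths, inside the vertex set `B`: if at least two
edges of the subgraph induced by `B` join `S` to `B \ S` whenever `S ⊆ B` separates `v` from `w`,
then there is an integral flow `θ` with values in `{-1, 0, 1}` inside `B`, and `v` and `w` are
in the same component of its support. -/
lemma exists_closed_trail [Fintype V] (B : Finset V) (v w : V) (hv : v ∈ B) (hw : w ∈ B)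
    (hcut : ∀ S ⊆ B, v ∈ S → w ∉ S →
      2 ≤ ((cut s t S).filter fun e => s e ∈ B ∧ t e ∈ B).card) :
    ∃ (θ : E → ℤ) (S : Finset V), S ⊆ B ∧ v ∈ S ∧ w ∈ S ∧ boundary s t θ = 0 ∧
      (∀ e, θ e = 0 ∨ θ e = 1 ∨ θ e = -1) ∧ (∀ e, θ e ≠ 0 → s e ∈ S ∧ t e ∈ S) ∧
      ∀ x ∈ S, ∃ q : E → ℤ, IsUnitFlow s t q v x ∧ ∀ e, q e ≠ 0 → θ e ≠ 0 := by
  classical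
  by_cases hvw : v = w
  · subst hvw
    refine ⟨0, {v}, by simpa using hv, by simp, by simp, by simp, by simp, by simp, ?_⟩
    intro x hx
    rw [Finset.mem_singleton.1 hx]
    exact ⟨0, .zero s t v, by simp⟩
  let I : E → Prop := fun e => s e ∈ B ∧ t e ∈ B
  -- A first path `p` from `v` to `w`.
  obtain ⟨p, hp, hp1⟩ : ∃ p : E → ℤ, IsUnitFlow s t p v w ∧
      ∀ e, p e = 0 ∨ (p e = 1 ∧ I e) ∨ (p e = -1 ∧ I e) := by
    obtain ⟨S, hvS, hS, hF, hB⟩ := exists_reachable (s := s) (t := t) I I v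
    by_cases hwS : w ∈ S
    · obtain ⟨q, hq, hq1, _⟩ := hS w hwS
      exact ⟨q, hq, hq1⟩
    exfalso
    have h2 := hcut (S ∩ B) Finset.inter_subset_right (by simp [hvS, hv]) (by simp [hwS])
    rw [Finset.card_eq_zero.2] at h2
    · omega
    · refine Finset.filter_eq_empty_iff.2 fun e he hI => ?_
      rw [mem_cut] at he
      have h1 := hF e hI
      have h2 := hB e hI
      simp only [Finset.mem_inter, hI.1, hI.2, and_true] at he
      exact he ⟨h1, h2⟩
  -- A second path `q` in the residual graph of `p`.
  obtain ⟨q, hq, hq1⟩ : ∃ q : E → ℤ, IsUnitFlow s t q v w ∧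
      ∀ e, q e = 0 ∨ (q e = 1 ∧ I e ∧ p e ≠ 1) ∨ (q e = -1 ∧ I e ∧ p e ≠ -1) := by
    obtain ⟨S, hvS, hS, hF, hB⟩ := exists_reachable (s := s) (t := t)
      (fun e => I e ∧ p e ≠ 1) (fun e => I e ∧ p e ≠ -1) v
    by_cases hwS : w ∈ S
    · obtain ⟨q, hq, hq1, _⟩ := hS w hwS
      exact ⟨q, hq, hq1⟩
    exfalso
    have h2 := hcut (S ∩ B) Finset.inter_subset_right (by simp [hvS, hv]) (by simp [hwS])
    have h3 := hp.sum (S := S ∩ B) (by simp [hvS, hv]) (by simp [hwS])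
    -- The flow `p` saturates all edges leaving `S ∩ B`, so there is only one.
    have h4 : ∑ e, ((if s e ∈ S ∩ B then p e else 0) - (if t e ∈ S ∩ B then p e else 0)) =
        ∑ e, if e ∈ (cut s t (S ∩ B)).filter I then (1 : ℤ) else 0 := by
      refine Finset.sum_congr rfl fun e _ => ?_
      by_cases hI : I e
      · have a1 := hF e
        have a2 := hB e
        simp only [Finset.mem_inter, Finset.mem_filter, mem_cut, hI, hI.1, hI.2, and_true,
          true_and] at a1 a2 ⊢
        by_cases b1 : s e ∈ S <;> by_cases b2 : t e ∈ S <;> simp_all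
      · have : p e = 0 := by
          rcases hp1 e with h | h | h
          · exact h
          · exact absurd h.2 hI
          · exact absurd h.2 hI
        simp [this, hI]
    rw [h4, Finset.sum_ite_mem, Finset.univ_inter, Finset.sum_const] at h3
    simp only [nsmul_eq_mul, mul_one] at h3
    have : 2 ≤ (((cut s t (S ∩ B)).filter I).card : ℤ) := by exact_mod_cast h2
    omega
  -- `g = p + q` carries two units from `v` to `w`.
  let g : E → ℤ := p + q
  have hg1 : ∀ e, g e = 0 ∨ g e = 1 ∨ g e = -1 := by
    intro e
    have a := hp1 e
    have b := hq1 e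
    simp only [g, Pi.add_apply]
    omega
  have hgI : ∀ e, g e ≠ 0 → I e := by
    intro e he
    by_contra hI
    have a := hp1 e
    have b := hq1 e
    simp only [hI, and_false, false_and, or_false] at a b
    exact he (by simp [g, a, b])
  -- A directed path `r` from `v` to `w` in the support of `g`.
  obtain ⟨r, hr, hr1⟩ : ∃ r : E → ℤ, IsUnitFlow s t r v w ∧
      ∀ e, r e = 0 ∨ (r e = 1 ∧ g e = 1) ∨ (r e = -1 ∧ g e = -1) := by
    obtain ⟨S, hvS, hS, hF, hB⟩ := exists_reachable (s := s) (t := t)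
      (fun e => g e = 1) (fun e => g e = -1) v
    by_cases hwS : w ∈ S
    · obtain ⟨q, hq, hq1, _⟩ := hS w hwS
      exact ⟨q, hq, hq1⟩
    exfalso
    have h3 := hp.sum hvS hwS
    have h4 := hq.sum hvS hwS
    have h5 : ∑ e, ((if s e ∈ S then g e else 0) - (if t e ∈ S then g e else 0)) ≤ 0 := by
      refine Finset.sum_nonpos fun e _ => ?_
      have a1 := hF e
      have a2 := hB e
      rcases hg1 e with h | h | h <;> simp only [h] at a1 a2 ⊢ <;>
        by_cases b1 : s e ∈ S <;> by_cases b2 : t e ∈ S <;> simp_all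
    have h6 : ∑ e, ((if s e ∈ S then g e else 0) - (if t e ∈ S then g e else 0)) = 1 + 1 := by
      trans 1 + ∑ e, ((if s e ∈ S then q e else 0) - (if t e ∈ S then q e else 0))
      swap
      · rw [h4]
      rw [← h3, ← Finset.sum_add_distrib]
      refine Finset.sum_congr rfl fun e _ => ?_
      simp only [g, Pi.add_apply]
      split_ifs <;> ring
    omega
  -- Reversing the remaining path turns `g` into a circulation with the same support.
  let θ : E → ℤ := r + r - g
  have hθ : boundary s t θ = 0 := by
    simp only [θ, g, map_sub, map_add]
    rw [hr, hp, hq, sub_self]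
  have hθ1 : ∀ e, θ e = 0 ∨ θ e = 1 ∨ θ e = -1 := by
    intro e
    have a := hr1 e
    have b := hg1 e
    simp only [θ, Pi.add_apply, Pi.sub_apply]
    omega
  have hθg : ∀ e, θ e ≠ 0 → g e ≠ 0 := by
    intro e
    have a := hr1 e
    have b := hg1 e
    simp only [θ, Pi.add_apply, Pi.sub_apply]
    omega
  have hrθ : ∀ e, r e ≠ 0 → θ e ≠ 0 := by
    intro e
    have a := hr1 e
    have b := hg1 e
    simp only [θ, Pi.add_apply, Pi.sub_apply]
    omega
  -- The component of `v` in the support of `θ`.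
  obtain ⟨S, hvS, hS, hF, hB⟩ := exists_reachable (s := s) (t := t)
    (fun e => θ e ≠ 0) (fun e => θ e ≠ 0) v
  have hwS : w ∈ S := by
    by_contra hwS
    have h := hr.sum hvS hwS
    rw [Finset.sum_eq_zero] at h
    · omega
    · intro e _
      by_cases he : r e = 0
      · simp [he]
      · have a1 := hF e (hrθ e he)
        have a2 := hB e (hrθ e he)
        by_cases b1 : s e ∈ S <;> by_cases b2 : t e ∈ S <;> simp_all
  have hSiff : ∀ e, θ e ≠ 0 → (s e ∈ S ↔ t e ∈ S) := fun e he => ⟨hF e he, hB e he⟩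
  have hSB : S ⊆ B := by
    intro x hx
    by_contra hxB
    obtain ⟨q', hq', hq1', hqS'⟩ := hS x hx
    have h := hq'.sum hv hxB
    rw [Finset.sum_eq_zero] at h
    · omega
    · intro e _
      by_cases he : q' e = 0
      · simp [he]
      · have hθe : θ e ≠ 0 := by
          rcases hq1' e with h | h | h
          · exact absurd h he
          · exact h.2
          · exact h.2
        have := hgI e (hθg e hθe)
        simp [this.1, this.2]
  refine ⟨fun e => if s e ∈ S then θ e else 0, S, hSB, hvS, hwS,
    boundary_restrict s t θ S hSiff hθ, fun e => ?_, fun e he => ?_, fun x hx => ?_⟩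
  · have := hθ1 e
    dsimp only
    split_ifs
    · exact this
    · simp
  · have h : s e ∈ S ∧ θ e ≠ 0 := by simpa using he
    exact ⟨h.1, (hSiff e h.2).1 h.1⟩
  · obtain ⟨q', hq', hq1', hqS'⟩ := hS x hx
    have hq2' : ∀ e, q' e ≠ 0 → θ e ≠ 0 := by
      intro e he
      rcases hq1' e with h | h | h
      · exact absurd h he
      · exact h.2
      · exact h.2
    exact ⟨q', hq', fun e he => by simpa [(hqS' e he).1] using hq2' e he⟩

end FlowCount

/-! ### Growing a flow over `ZMod 3` that vanishes only on an even subgraph -/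

namespace FlowCount

variable {V E : Type*} [Fintype E] [DecidableEq V] {s t : E → V}

/-- The subgraph with vertex set `U` and edge set `X` is connected, `C ⊆ X` is an even subgraph,
and for every choice `h` of one forbidden value per edge there is a flow over `ZMod 3` on `X` that
avoids `h` on `X \ C` and on at least two thirds of `C`. -/
structure IsAvoiding (s t : E → V) (U : Finset V) (X C : Finset E) : Prop where
  inside : ∀ e ∈ X, s e ∈ U ∧ t e ∈ U
  subset : C ⊆ X
  connected : ∀ x ∈ U, ∀ y ∈ U, ∃ q : E → ℤ, IsUnitFlow s t q x y ∧ ∀ e, q e ≠ 0 → e ∈ X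
  even : boundary s t ((C : Set E).indicator (1 : E → ZMod 2)) = 0
  avoid : ∀ h : E → ZMod 3, ∃ ψ : E → ZMod 3, boundary s t ψ = 0 ∧ (∀ e, e ∉ X → ψ e = 0) ∧
    (∀ e ∈ X, e ∉ C → ψ e ≠ h e) ∧ 3 * (C.filter fun e => ψ e = h e).card ≤ C.card

lemma IsAvoiding.singleton (v : V) : IsAvoiding s t {v} ∅ ∅ where
  inside := by simp
  subset := by simp
  connected x hx y hy := by
    rw [Finset.mem_singleton.1 hx, Finset.mem_singleton.1 hy]
    exact ⟨0, .zero s t v, by simp⟩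
  even := by
    rw [Finset.coe_empty, Set.indicator_empty]
    exact map_zero _
  avoid h := ⟨0, by simp⟩

lemma exists_mul_ne_and_mul_ne : ∀ a b h k : ZMod 3, a ≠ 0 → b ≠ 0 →
    ∃ c : ZMod 3, c * a ≠ h ∧ c * b ≠ k := by decide

omit [Fintype E] in
/-- On average, a multiple of `θ` agrees with `h` on a third of the edges. -/
lemma exists_mul_eq_le_third (D : Finset E) (θ h : E → ZMod 3) (hθ : ∀ e ∈ D, θ e ≠ 0) :
    ∃ r : ZMod 3, 3 * (D.filter fun e => r * θ e = h e).card ≤ D.card := by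
  have key : ∀ a b : ZMod 3, a ≠ 0 →
      (Finset.univ.filter fun r : ZMod 3 => r * a = b).card = 1 := by decide
  have hsum : ∑ r : ZMod 3, (D.filter fun e => r * θ e = h e).card = D.card := by
    simp only [Finset.card_filter]
    rw [Finset.sum_comm, Finset.card_eq_sum_ones]
    refine Finset.sum_congr rfl fun e he => ?_
    rw [← Finset.card_filter]
    exact key _ _ (hθ e he)
  obtain ⟨r, -, hr⟩ := Finset.exists_le_of_sum_le (s := (Finset.univ : Finset (ZMod 3)))
    (f := fun r => 3 * (D.filter fun e => r * θ e = h e).card) (g := fun _ => D.card)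
    Finset.univ_nonempty (by
      rw [← Finset.mul_sum, hsum]
      simp [ZMod.card])
  exact ⟨r, hr⟩

lemma exists_single_unitFlow (e : E) (U B : Finset V)
    (h : (s e ∈ U ∧ t e ∈ B) ∨ (t e ∈ U ∧ s e ∈ B)) :
    ∃ u ∈ U, ∃ v ∈ B, ∃ ε : E → ℤ, IsUnitFlow s t ε u v ∧ (∀ e', e' ≠ e → ε e' = 0) ∧
      (ε e = 1 ∨ ε e = -1) := by
  classical
  rcases h with h | h
  · exact ⟨_, h.1, _, h.2, _, .single e, fun e' h => by simp [h], by simp⟩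
  · exact ⟨_, h.1, _, h.2, _, (IsUnitFlow.single e).neg, fun e' h => by simp [h], by simp⟩

/-- If `B` is minimal among the sets left by at most one edge of the spanning subgraph `O`, then
`B` induces a `2`-edge-connected graph. -/
lemma two_le_card_cut_inside {B S : Finset V} (O : E → Prop) [DecidablePred O]
    (hB : ((cut s t B).filter O).card ≤ 1)
    (hmin : ∀ T : Finset V, T.Nonempty → T ⊂ B → 2 ≤ ((cut s t T).filter O).card)
    (hS : S.Nonempty) (hS' : S ⊂ B) :
    2 ≤ ((cut s t S).filter fun e => s e ∈ B ∧ t e ∈ B).card := by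
  have hSB := hS'.1
  -- At most one edge leaves `B`; it ends in `S` or in `B \ S`, and the other of these two sets
  -- is left only by edges inside `B`.
  by_cases hx : ∃ e ∈ (cut s t B).filter O, s e ∈ S ∨ t e ∈ S
  · obtain ⟨e₀, he₀, hS₀⟩ := hx
    refine (hmin (B \ S) (Finset.sdiff_nonempty.2 hS'.2)
      (Finset.sdiff_ssubset hSB hS)).trans (Finset.card_le_card fun e he => ?_)
    have huniq : e ∈ (cut s t B).filter O → e = e₀ := fun h =>
      Finset.card_le_one.1 hB _ h _ he₀
    simp only [Finset.mem_filter, mem_cut, Finset.mem_sdiff] at he he₀ huniq ⊢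
    have a1 := @hSB (s e)
    have a2 := @hSB (t e)
    clear hmin hB hS' hSB
    by_cases hee : e = e₀
    · subst hee; tauto
    · have := mt huniq hee
      clear he₀ hS₀ huniq hee
      tauto
  · refine (hmin S hS hS').trans (Finset.card_le_card fun e he => ?_)
    have hx' : e ∈ (cut s t B).filter O → ¬(s e ∈ S ∨ t e ∈ S) := fun h h' => hx ⟨e, h, h'⟩
    simp only [Finset.mem_filter, mem_cut] at he hx' ⊢
    have a1 := @hSB (s e)
    have a2 := @hSB (t e)
    clear hmin hB hS' hSB hx
    tauto

/-- Outside a proper vertex set `U` of a `3`-edge-connected graph there is a closed trail with two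
edges to `U`. It is found in a minimal set `B` left by at most one edge of the graph minus `U`:
at least two of the edges leaving `B` go to `U`, and `B` induces a `2`-edge-connected graph. The
trail is given by an integral flow `θ` with values in `{-1, 0, 1}`, and `S` is the set of its
vertices. -/
lemma exists_ear [Fintype V] (hG : EdgeConnected s t 3) (U : Finset V) (hU : U.Nonempty)
    (hU' : U ≠ Finset.univ) :
    ∃ (e f : E) (S : Finset V) (θ : E → ℤ), e ≠ f ∧ Disjoint U S ∧
      ((s e ∈ U ∧ t e ∈ S) ∨ (t e ∈ U ∧ s e ∈ S)) ∧
      ((s f ∈ U ∧ t f ∈ S) ∨ (t f ∈ U ∧ s f ∈ S)) ∧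
      boundary s t θ = 0 ∧
      (∀ e, θ e = 0 ∨ θ e = 1 ∨ θ e = -1) ∧ (∀ e, θ e ≠ 0 → s e ∈ S ∧ t e ∈ S) ∧
      ∀ x ∈ S, ∀ y ∈ S, ∃ q : E → ℤ, IsUnitFlow s t q x y ∧ ∀ e, q e ≠ 0 → θ e ≠ 0 := by
  classical
  let O : E → Prop := fun e => s e ∉ U ∧ t e ∉ U
  let P : Finset V → Prop := fun B => B.Nonempty ∧ Disjoint U B ∧ ((cut s t B).filter O).card ≤ 1
  have h0 : P Uᶜ := by
    refine ⟨?_, disjoint_compl_right, ?_⟩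
    · rwa [← Finset.compl_ne_univ_iff_nonempty, compl_compl]
    · rw [Finset.card_eq_zero.2]
      · omega
      · refine Finset.filter_eq_empty_iff.2 fun e he hO => ?_
        rw [mem_cut] at he
        simp [hO.1, hO.2] at he
  obtain ⟨B, hB, hmin⟩ := Finset.exists_min_image (Finset.univ.filter P) Finset.card
    ⟨Uᶜ, by simpa using h0⟩
  simp only [Finset.mem_filter, Finset.mem_univ, true_and] at hB hmin
  obtain ⟨hBne, hUB, hB1⟩ := hB
  have hBU : ∀ x ∈ B, x ∉ U := fun x hx hxU => Finset.disjoint_left.1 hUB hxU hx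
  have hBuniv : B ≠ Finset.univ := by
    rintro rfl
    obtain ⟨u, hu⟩ := hU
    exact hBU u (by simp) hu
  have h3 := hG B hBne hBuniv
  rw [← Finset.card_filter_add_card_filter_not (s := cut s t B) O] at h3
  obtain ⟨e, he, f, hf, hef⟩ := Finset.one_lt_card.1
    (show 1 < ((cut s t B).filter fun e => ¬ O e).card by omega)
  have hends : ∀ e ∈ (cut s t B).filter (fun e => ¬ O e),
      (s e ∈ U ∧ t e ∈ B) ∨ (t e ∈ U ∧ s e ∈ B) := by
    intro e he
    rw [Finset.mem_filter, mem_cut] at he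
    have a1 := hBU (s e)
    have a2 := hBU (t e)
    simp only [O] at he
    tauto
  -- The ends of the two edges in `B`.
  obtain ⟨v, hv, hve⟩ : ∃ v ∈ B, (s e ∈ U ∧ t e = v) ∨ (t e ∈ U ∧ s e = v) := by
    rcases hends e he with h | h
    · exact ⟨_, h.2, Or.inl ⟨h.1, rfl⟩⟩
    · exact ⟨_, h.2, Or.inr ⟨h.1, rfl⟩⟩
  obtain ⟨w, hw, hwf⟩ : ∃ w ∈ B, (s f ∈ U ∧ t f = w) ∨ (t f ∈ U ∧ s f = w) := by
    rcases hends f hf with h | h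
    · exact ⟨_, h.2, Or.inl ⟨h.1, rfl⟩⟩
    · exact ⟨_, h.2, Or.inr ⟨h.1, rfl⟩⟩
  have hcut : ∀ S ⊆ B, v ∈ S → w ∉ S →
      2 ≤ ((cut s t S).filter fun e => s e ∈ B ∧ t e ∈ B).card := by
    intro S hS hvS hwS
    refine two_le_card_cut_inside O hB1 (fun T hT hTB => ?_) ⟨v, hvS⟩ ⟨hS, fun h => hwS (h hw)⟩
    by_contra hlt
    have h1 := hmin T ⟨hT, hUB.mono_right hTB.1, by omega⟩
    have h2 := Finset.card_lt_card hTB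
    omega
  obtain ⟨θ, S, hSB, hvS, hwS, hθ, hθ1, hθS, hconn⟩ := exists_closed_trail B v w hv hw hcut
  refine ⟨e, f, S, θ, hef, hUB.mono_right hSB, ?_, ?_, hθ, hθ1, hθS, fun x hx y hy => ?_⟩
  · rcases hve with h | h
    · exact Or.inl ⟨h.1, h.2 ▸ hvS⟩
    · exact Or.inr ⟨h.1, h.2 ▸ hvS⟩
  · rcases hwf with h | h
    · exact Or.inl ⟨h.1, h.2 ▸ hwS⟩
    · exact Or.inr ⟨h.1, h.2 ▸ hwS⟩
  · obtain ⟨p, hp, hp1⟩ := hconn x hx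
    obtain ⟨q, hq, hq1⟩ := hconn y hy
    refine ⟨-p + q, hp.neg.add hq, fun e he => ?_⟩
    by_cases h : p e = 0
    · exact hq1 e fun h' => he (by simp [h, h'])
    · exact hp1 e h

/-- Adding a closed trail and two edges joining it to `U`. A multiple of a flow through the two
edges avoids the forbidden values on both of them, and a multiple of the flow along the trail
then avoids two thirds of the forbidden values on the trail. -/
lemma IsAvoiding.extend [Fintype V] {U : Finset V} {X C : Finset E} (hX : IsAvoiding s t U X C)
    (hG : EdgeConnected s t 3) (hU : U.Nonempty) (hU' : U ≠ Finset.univ) :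
    ∃ U' X' C', U ⊂ U' ∧ IsAvoiding s t U' X' C' := by
  classical
  obtain ⟨e, f, S, θ, hef, hUS, he, hf, hθ, hθ1, hθS, hconn⟩ := exists_ear hG U hU hU'
  have hd : ∀ x, x ∈ U → x ∉ S := fun x h h' => Finset.disjoint_left.1 hUS h h'
  obtain ⟨u, hu, v, hv, ε, hε, hε0, hε1⟩ := exists_single_unitFlow e U S he
  obtain ⟨u', hu', w, hw, η, hη, hη0, hη1⟩ := exists_single_unitFlow f U S hf
  obtain ⟨p, hp, hpX⟩ := hX.connected u' hu' u hu
  obtain ⟨q, hq, hqθ⟩ := hconn v hv w hw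
  let D : Finset E := Finset.univ.filter fun e => θ e ≠ 0
  have hD : ∀ e, e ∈ D ↔ θ e ≠ 0 := by simp [D]
  have hDX : ∀ e ∈ D, e ∉ X := fun e h h' => hd _ (hX.inside e h').1 (hθS e ((hD e).1 h)).1
  have heX : e ∉ X := fun h => by
    have := hX.inside e h
    rcases he with h' | h'
    · exact hd _ this.2 h'.2
    · exact hd _ this.1 h'.2
  have hfX : f ∉ X := fun h => by
    have := hX.inside f h
    rcases hf with h' | h'
    · exact hd _ this.2 h'.2
    · exact hd _ this.1 h'.2
  have heD : e ∉ D := fun h => by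
    have := hθS e ((hD e).1 h)
    rcases he with h' | h'
    · exact hd _ h'.1 this.1
    · exact hd _ h'.1 this.2
  have hfD : f ∉ D := fun h => by
    have := hθS f ((hD f).1 h)
    rcases hf with h' | h'
    · exact hd _ h'.1 this.1
    · exact hd _ h'.1 this.2
  have hp0 : ∀ e, e ∉ X → p e = 0 := fun e h => by_contra fun h' => h (hpX e h')
  have hq0 : ∀ e, e ∉ D → q e = 0 := fun e h => by_contra fun h' => h ((hD e).2 (hqθ e h'))
  -- The flow through the two new edges.
  let κ : E → ℤ := ε + q + -η + p
  have hκ : boundary s t κ = 0 := by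
    have := ((hε.add hq).add hη.neg).add hp
    unfold IsUnitFlow at this
    rw [this, sub_self]
  have hκe : κ e = 1 ∨ κ e = -1 := by
    simpa [κ, hq0 e heD, hη0 e hef, hp0 e heX] using hε1
  have hκf : κ f = 1 ∨ κ f = -1 := by
    have : κ f = - η f := by simp [κ, hq0 f hfD, hε0 f hef.symm, hp0 f hfX]
    omega
  have hunit : ∀ k : ℤ, k = 1 ∨ k = -1 → (k : ZMod 3) ≠ 0 := by
    rintro k (rfl | rfl) <;> decide
  refine ⟨U ∪ S, X ∪ {e, f} ∪ D, C ∪ D, ?_, ?_, ?_, ?_, ?_, ?_⟩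
  · exact ⟨Finset.subset_union_left, fun h => hd v (h (Finset.mem_union_right U hv)) hv⟩
  · intro g hg
    simp only [Finset.mem_union, Finset.mem_insert, Finset.mem_singleton] at hg ⊢
    rcases hg with (hg | rfl | rfl) | hg
    · exact ⟨Or.inl (hX.inside g hg).1, Or.inl (hX.inside g hg).2⟩
    · exact he.elim (fun h => ⟨Or.inl h.1, Or.inr h.2⟩) fun h => ⟨Or.inr h.2, Or.inl h.1⟩
    · exact hf.elim (fun h => ⟨Or.inl h.1, Or.inr h.2⟩) fun h => ⟨Or.inr h.2, Or.inl h.1⟩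
    · exact ⟨Or.inr (hθS g ((hD g).1 hg)).1, Or.inr (hθS g ((hD g).1 hg)).2⟩
  · intro g hg
    rcases Finset.mem_union.1 hg with hg | hg
    · exact Finset.mem_union_left _ (Finset.mem_union_left _ (hX.subset hg))
    · exact Finset.mem_union_right _ hg
  · -- Every vertex is reached from `v`.
    have hreach : ∀ x ∈ U ∪ S, ∃ r : E → ℤ, IsUnitFlow s t r v x ∧
        ∀ g, r g ≠ 0 → g ∈ X ∪ {e, f} ∪ D := by
      intro x hx
      rcases Finset.mem_union.1 hx with hx | hx
      · obtain ⟨r, hr, hr1⟩ := hX.connected u hu x hx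
        refine ⟨-ε + r, hε.neg.add hr, fun g hg => ?_⟩
        by_cases hge : g = e
        · simp [hge]
        · have := hr1 g (by simpa [hε0 g hge] using hg)
          simp [this]
      · obtain ⟨r, hr, hr1⟩ := hconn v hv x hx
        exact ⟨r, hr, fun g hg => Finset.mem_union_right _ ((hD g).2 (hr1 g hg))⟩
    intro x hx y hy
    obtain ⟨a, ha, ha1⟩ := hreach x hx
    obtain ⟨b, hb, hb1⟩ := hreach y hy
    refine ⟨-a + b, ha.neg.add hb, fun g hg => ?_⟩
    by_cases h : a g = 0
    · exact hb1 g fun h' => hg (by simp [h, h'])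
    · exact ha1 g h
  · have h1 : ((C ∪ D : Finset E) : Set E).indicator (1 : E → ZMod 2) =
        (C : Set E).indicator (1 : E → ZMod 2) + fun g => (θ g : ZMod 2) := by
      ext g
      have hCD : g ∈ C → g ∉ D := fun h h' => hDX g h' (hX.subset h)
      have h2 := hD g
      by_cases hgC : g ∈ C
      · have : θ g = 0 := by_contra fun h => hCD hgC (h2.2 h)
        simp [hgC, this]
      · rcases hθ1 g with h | h | h <;> simp [Set.indicator, hgC, h2, h]
    rw [h1, map_add, hX.even, boundary_intCast, hθ]
    ext; simp
  · intro h
    obtain ⟨c, hc1, hc2⟩ := exists_mul_ne_and_mul_ne (κ e) (κ f) (h e) (h f)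
      (hunit _ hκe) (hunit _ hκf)
    obtain ⟨r, hr⟩ := exists_mul_eq_le_third D (fun g => (θ g : ZMod 3))
      (fun g => h g - c * (κ g : ZMod 3)) (fun g hg => by
        exact hunit _ ((hθ1 g).resolve_left ((hD g).1 hg)))
    obtain ⟨ψ, hψ, hψ0, hψ1, hψ2⟩ := hX.avoid fun g => h g - c * (κ g : ZMod 3)
    let κ' : E → ZMod 3 := fun g => (κ g : ZMod 3)
    let θ' : E → ZMod 3 := fun g => (θ g : ZMod 3)
    have hθ0 : ∀ g, g ∉ D → θ g = 0 := fun g hg => by_contra fun h => hg ((hD g).2 h)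
    have hX1 : ∀ g ∈ X, (c • κ' + r • θ' + ψ) g = c * κ g + ψ g := fun g hg => by
      simp [κ', θ', hθ0 g fun h => hDX g h hg]
    have hD1 : ∀ g ∈ D, (c • κ' + r • θ' + ψ) g = c * κ g + r * θ g := fun g hg => by
      simp [κ', θ', hψ0 g (hDX g hg)]
    refine ⟨c • κ' + r • θ' + ψ, ?_, ?_, ?_, ?_⟩
    · rw [map_add, map_add, boundary_smul, boundary_smul, hψ, boundary_intCast, boundary_intCast,
        hκ, hθ]
      ext; simp
    · intro g hg
      simp only [Finset.mem_union, Finset.mem_insert, Finset.mem_singleton, not_or] at hg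
      obtain ⟨⟨g1, g2, g3⟩, g4⟩ := hg
      simp [κ', θ', κ, hθ0 g g4, hψ0 g g1, hε0 g g2, hη0 g g3, hp0 g g1, hq0 g g4]
    · intro g hg hgC
      simp only [Finset.mem_union, not_or] at hgC
      rcases Finset.mem_union.1 hg with hg | hg
      · rcases Finset.mem_union.1 hg with hg | hg
        · rw [hX1 g hg]
          intro h'
          exact hψ1 g hg hgC.1 (by rw [← h']; ring)
        · rcases Finset.mem_insert.1 hg with rfl | hg
          · simpa [κ', θ', hθ0 g heD, hψ0 g heX] using hc1
          · rw [Finset.mem_singleton] at hg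
            subst hg
            simpa [κ', θ', hθ0 g hfD, hψ0 g hfX] using hc2
      · exact absurd hg hgC.2
    · have hdisj : Disjoint C D :=
        Finset.disjoint_left.2 fun g h h' => hDX g h' (hX.subset h)
      rw [Finset.card_union_of_disjoint hdisj, Finset.filter_union]
      have e1 : (C.filter fun g => (c • κ' + r • θ' + ψ) g = h g) =
          C.filter fun g => ψ g = h g - c * κ g := by
        refine Finset.filter_congr fun g hg => ?_
        rw [hX1 g (hX.subset hg), eq_sub_iff_add_eq, add_comm]
      have e2 : (D.filter fun g => (c • κ' + r • θ' + ψ) g = h g) =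
          D.filter fun g => r * θ g = h g - c * κ g := by
        refine Finset.filter_congr fun g hg => ?_
        rw [hD1 g hg, eq_sub_iff_add_eq, add_comm]
      rw [e1, e2]
      have := Finset.card_union_le (C.filter fun g => ψ g = h g - c * κ g)
        (D.filter fun g => r * θ g = h g - c * κ g)
      omega

/-- A quantitative form of the main step of Seymour's `6`-flow theorem: a `3`-edge-connected graph
has an even subgraph `C` and a flow over `ZMod 3` whose zeros lie in `C` and make up at most a
third of it. -/
theorem exists_flow_zeros_le [Fintype V] [Nonempty V] (hG : EdgeConnected s t 3) :
    ∃ (C : Finset E) (ψ : E → ZMod 3),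
      boundary s t ((C : Set E).indicator (1 : E → ZMod 2)) = 0 ∧ boundary s t ψ = 0 ∧
      (∀ e, e ∉ C → ψ e ≠ 0) ∧ 3 * (C.filter fun e => ψ e = 0).card ≤ C.card := by
  classical
  obtain ⟨v⟩ := ‹Nonempty V›
  let P : Finset V → Prop := fun U => U.Nonempty ∧ ∃ X C, IsAvoiding s t U X C
  obtain ⟨U, hU, hmax⟩ := Finset.exists_max_image (Finset.univ.filter P) Finset.card
    ⟨{v}, by simpa [P] using ⟨_, _, IsAvoiding.singleton v⟩⟩
  simp only [Finset.mem_filter, Finset.mem_univ, true_and] at hU hmax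
  obtain ⟨hne, X, C, hX⟩ := hU
  have hUu : U = Finset.univ := by
    by_contra hU'
    obtain ⟨U', X', C', hlt, h'⟩ := hX.extend hG hne hU'
    have := hmax U' ⟨hne.mono hlt.1, X', C', h'⟩
    have := Finset.card_lt_card hlt
    omega
  subst hUu
  -- Send one unit around a cycle through each edge outside the spanning connected subgraph `X`.
  choose q hq hqX using fun e => hX.connected (t e) (Finset.mem_univ _) (s e) (Finset.mem_univ _)
  let κ : E → ℤ := ∑ e ∈ Xᶜ, (Pi.single e 1 + q e)
  have hκ : boundary s t κ = 0 := by
    simp only [κ, map_sum]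
    refine Finset.sum_eq_zero fun e _ => ?_
    have := (IsUnitFlow.single (s := s) (t := t) e).add (hq e)
    unfold IsUnitFlow at this
    rw [this, sub_self]
  have hκ1 : ∀ g, g ∉ X → κ g = 1 := by
    intro g hg
    have h0 : ∀ e, q e g = 0 := fun e => by_contra fun h => hg (hqX e g h)
    simp [κ, Finset.sum_apply, h0, Finset.sum_pi_single, hg]
  obtain ⟨ψ, hψ, hψ0, hψ1, hψ2⟩ := hX.avoid fun g => -(κ g : ZMod 3)
  refine ⟨C, (fun g => (κ g : ZMod 3)) + ψ, hX.even, ?_, fun g hg => ?_, ?_⟩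
  · rw [map_add, hψ, boundary_intCast, hκ]
    ext; simp
  · by_cases hgX : g ∈ X
    · have := hψ1 g hgX hg
      rwa [Pi.add_apply, ne_eq, add_comm, add_eq_zero_iff_eq_neg]
    · simp [hκ1 g hgX, hψ0 g hgX]
  · simpa only [Pi.add_apply, add_comm, add_eq_zero_iff_eq_neg] using hψ2

end FlowCount

/-! ### Counting flows of `3`-edge-connected graphs -/

namespace FlowCount

variable {V E : Type*} [Fintype V] [Fintype E] [DecidableEq V] {s t : E → V}

/-- In a graph of minimum degree three, an even subgraph has at most `2 * (m - n)` edges: its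
degree `k` at a vertex of degree `d ≥ 3` is even and at most `d`, so `k ≤ 2 * (d - 2)`. -/
lemma card_add_le_of_even (hG : EdgeConnected s t 3) (hV : 2 ≤ Fintype.card V) {C : Finset E}
    (hC : boundary s t ((C : Set E).indicator (1 : E → ZMod 2)) = 0) :
    C.card + 2 * Fintype.card V ≤ 2 * Fintype.card E := by
  classical
  let d : Finset E → V → ℕ := fun F v =>
    ∑ e ∈ F, ((if s e = v then 1 else 0) + (if t e = v then 1 else 0))
  have hsum : ∀ F, ∑ v, d F v = 2 * F.card := by
    intro F
    simp only [d]
    rw [Finset.sum_comm]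
    simp [Finset.sum_add_distrib, two_mul, mul_two]
  have heven : ∀ v, Even (d C v) := by
    intro v
    rw [← ZMod.natCast_eq_zero_iff_even]
    refine Eq.trans ?_ (congrFun hC v)
    rw [boundary_apply, Nat.cast_sum,
      ← Finset.sum_subset (Finset.subset_univ C) fun e _ he => by simp [he]]
    refine Finset.sum_congr rfl fun e he => ?_
    simp only [Set.indicator, Finset.mem_coe, he, if_true, Pi.one_apply]
    by_cases h1 : s e = v <;> by_cases h2 : t e = v <;> simp only [h1, h2, if_true, if_false] <;>
      decide
  have hle : ∀ v, d C v ≤ d Finset.univ v := fun v =>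
    Finset.sum_le_sum_of_subset (Finset.subset_univ C)
  have h3 : ∀ v, 3 ≤ d Finset.univ v := by
    intro v
    have hne : ({v} : Finset V) ≠ Finset.univ := by
      intro h
      have := congrArg Finset.card h
      rw [Finset.card_singleton, Finset.card_univ] at this
      omega
    refine (hG {v} (by simp) hne).trans ?_
    rw [cut, Finset.card_filter]
    refine Finset.sum_le_sum fun e _ => ?_
    simp only [Finset.mem_singleton]
    by_cases h1 : s e = v <;> by_cases h2 : t e = v <;> simp [h1, h2]
  have key : ∑ v, (d C v + 4) ≤ ∑ v, 2 * d Finset.univ v := by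
    refine Finset.sum_le_sum fun v _ => ?_
    have a1 := hle v
    have a2 := h3 v
    obtain ⟨k, hk⟩ := heven v
    omega
  rw [Finset.sum_add_distrib, ← Finset.mul_sum, hsum, hsum, Finset.sum_const, Finset.card_univ,
    Finset.card_univ, smul_eq_mul] at key
  omega

/-- If `ψ` vanishes only on the part `Z` of an even subgraph `C`, then the sum of `C` and a flow
over `ZMod 2` that vanishes on `Z` is nonzero on `Z`; such flows form a space of codimension at
most `n + #Z`. -/
lemma two_pow_card_le (C : Finset E) (ψ : E → ZMod 3)
    (hC : boundary s t ((C : Set E).indicator (1 : E → ZMod 2)) = 0)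
    (hψ : boundary s t ψ = 0) (hψC : ∀ e, e ∉ C → ψ e ≠ 0) :
    2 ^ Fintype.card E ≤ (nzFlows s t (ZMod 2 × ZMod 3)).ncard *
      2 ^ (Fintype.card V + (C.filter fun e => ψ e = 0).card) := by
  classical
  set Z := C.filter fun e => ψ e = 0 with hZ
  let f : (E → ZMod 2) →+ (V → ZMod 2) × (Z → ZMod 2) :=
    (boundary s t).prod
      { toFun := fun y e => y e, map_zero' := rfl, map_add' := fun _ _ => rfl }
  have hker : Nat.card f.ker ≤ (nzFlows s t (ZMod 2 × ZMod 3)).ncard := by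
    let F : f.ker → E → ZMod 2 × ZMod 3 := fun y e =>
      ((C : Set E).indicator (1 : E → ZMod 2) e + y.1 e, ψ e)
    have hF : Function.Injective F := by
      intro y y' h
      ext e
      simpa [F] using congrArg Prod.fst (congrFun h e)
    rw [← Set.ncard_range_of_injective hF]
    refine Set.ncard_le_ncard ?_ (Set.toFinite _)
    rintro _ ⟨⟨y, hy⟩, rfl⟩
    rw [AddMonoidHom.mem_ker] at hy
    have hy1 : boundary s t y = 0 := congrArg Prod.fst hy
    have hy2 : ∀ e ∈ Z, y e = 0 := fun e he => congrFun (congrArg Prod.snd hy) ⟨e, he⟩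
    refine ⟨?_, fun e he => ?_⟩
    · ext v
      · rw [← AddMonoidHom.coe_fst]
        rw [← congrFun (boundary_map s t (AddMonoidHom.fst (ZMod 2) (ZMod 3)) _) v]
        have : boundary s t ((C : Set E).indicator (1 : E → ZMod 2) + y) = 0 := by
          rw [map_add, hC, hy1, add_zero]
        exact congrFun this v
      · rw [← AddMonoidHom.coe_snd]
        rw [← congrFun (boundary_map s t (AddMonoidHom.snd (ZMod 2) (ZMod 3)) _) v]
        exact congrFun hψ v
    · have h1 : (C : Set E).indicator (1 : E → ZMod 2) e + y e = 0 := congrArg Prod.fst he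
      have h2 : ψ e = 0 := congrArg Prod.snd he
      have heC : e ∈ C := by_contra fun h => hψC e h h2
      rw [hy2 e (by simp [hZ, heC, h2])] at h1
      simp [heC] at h1
  have hrange : Nat.card f.range ≤ 2 ^ (Fintype.card V + Z.card) := by
    refine (Nat.card_le_card_of_injective _ Subtype.val_injective).trans ?_
    simp [Nat.card_eq_fintype_card, ZMod.card, pow_add]
  have h := f.ker.card_mul_index
  rw [AddSubgroup.index_ker] at h
  have hE : Nat.card (E → ZMod 2) = 2 ^ Fintype.card E := by
    simp [Nat.card_eq_fintype_card, ZMod.card]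
  rw [← hE, ← h]
  exact Nat.mul_le_mul hker hrange

lemma rpow_le_of_pow_le {m n z N : ℕ} (h : 2 ^ m ≤ N * 2 ^ (n + z)) {x : ℝ}
    (hx : x ≤ m - n - z) : (2 : ℝ) ^ x ≤ N := by
  refine (Real.rpow_le_rpow_of_exponent_le one_le_two hx).trans ?_
  rw [sub_sub, Real.rpow_sub two_pos, div_le_iff₀ (Real.rpow_pos_of_pos two_pos _)]
  exact_mod_cast h

theorem EdgeConnected.two_rpow_le_of_three (hG : EdgeConnected s t 3) :
    (2 : ℝ) ^ (2 * ((Fintype.card E : ℝ) - Fintype.card V) / 9) ≤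
      (nzFlows s t (ZMod 2 × ZMod 3)).ncard := by
  classical
  rcases le_or_gt 2 (Fintype.card V) with hV | hV
  · have : Nonempty V := Fintype.card_pos_iff.1 (by omega)
    obtain ⟨C, ψ, hC, hψ, hψC, hz⟩ := exists_flow_zeros_le hG
    refine rpow_le_of_pow_le (two_pow_card_le C ψ hC hψ hψC) ?_
    have h1 := card_add_le_of_even hG hV hC
    have h2 : 3 * ((C.filter fun e => ψ e = 0).card : ℝ) ≤ C.card := by exact_mod_cast hz
    have h3 : (C.card : ℝ) + 2 * Fintype.card V ≤ 2 * Fintype.card E := by exact_mod_cast h1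
    have h4 : (0 : ℝ) ≤ C.card := Nat.cast_nonneg _
    linarith
  · have hs : Subsingleton V := Fintype.card_le_one_iff_subsingleton.1 (by omega)
    have h := two_pow_card_le (s := s) (t := t) ∅ 1 (by
      rw [Finset.coe_empty, Set.indicator_empty]
      exact map_zero _) (by
      ext v
      rw [boundary_apply]
      exact Finset.sum_eq_zero fun e _ => by simp [Subsingleton.elim (s e) (t e)]) (by simp)
    rw [Finset.filter_empty, Finset.card_empty] at h
    rcases le_or_gt (Fintype.card V) (Fintype.card E) with hle | hlt
    · refine rpow_le_of_pow_le h ?_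
      have : (Fintype.card V : ℝ) ≤ Fintype.card E := by exact_mod_cast hle
      push_cast
      linarith
    · -- A single vertex without edges: the exponent is negative.
      have hN : 1 ≤ (nzFlows s t (ZMod 2 × ZMod 3)).ncard := by
        by_contra hN
        simp [show (nzFlows s t (ZMod 2 × ZMod 3)).ncard = 0 by omega] at h
      have : (Fintype.card E : ℝ) ≤ Fintype.card V := by exact_mod_cast hlt.le
      refine (Real.rpow_le_one_of_one_le_of_nonpos one_le_two (by linarith)).trans ?_
      exact_mod_cast hN

end FlowCount

/-! ### Contracting an edge of a `2`-edge cut -/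

namespace FlowCount

variable {V E : Type*} [Fintype V] [Fintype E] [DecidableEq V] [DecidableEq E]

/-- The contraction of the edge `e` on vertices: the head of `e` is identified with its tail. -/
def contract (s t : E → V) (e : E) (he : s e ≠ t e) (x : V) : {x // x ≠ t e} :=
  if h : x = t e then ⟨s e, he⟩ else ⟨x, h⟩

variable {s t : E → V} {e : E} (he : s e ≠ t e)

omit [Fintype V] [Fintype E] [DecidableEq E] in
lemma contract_eq_iff {x v : V} (hs : v ≠ s e) (ht : v ≠ t e) :
    contract s t e he x = ⟨v, ht⟩ ↔ x = v := by
  unfold contract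
  split_ifs with h
  · subst h; simp [hs.symm, ht.symm]
  · simp

lemma EdgeConnected.contract {k : ℕ} (hG : EdgeConnected s t k) :
    EdgeConnected (fun g : {g // g ≠ e} => contract s t e he (s g))
      (fun g => contract s t e he (t g)) k := by
  intro X hX hX'
  have hr : ∀ x : {x // x ≠ t e}, FlowCount.contract s t e he x = x := fun x => by
    simp [FlowCount.contract, x.2]
  have h := hG (Finset.univ.filter fun x => FlowCount.contract s t e he x ∈ X) (by
    obtain ⟨x, hx⟩ := hX
    exact ⟨x, by simpa [hr] using hx⟩) (fun h => hX' (by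
    ext x
    have : (x : V) ∈ Finset.univ.filter fun x => FlowCount.contract s t e he x ∈ X := by
      rw [h]; simp
    simpa [hr] using this))
  refine h.trans ?_
  rw [← Finset.card_map (Function.Embedding.subtype _)]
  refine Finset.card_le_card fun g hg => ?_
  have hge : g ≠ e := by
    rintro rfl
    simp [mem_cut, FlowCount.contract, he] at hg
  simpa [mem_cut, hge] using hg

/-- A nowhere-zero flow of the contraction extends to the contracted edge `e`: its value there is
determined by the flow at the tail of `e`, and up to sign it is the value on the other edge of the
cut. -/
lemma ncard_nzFlows_contract_le {Γ : Type*} [AddCommGroup Γ] [Finite Γ] {f : E} (hef : f ≠ e)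
    {X : Finset V} (hX : cut s t X = {e, f}) :
    (nzFlows (fun g : {g // g ≠ e} => contract s t e he (s g))
      (fun g => contract s t e he (t g)) Γ).ncard ≤ (nzFlows s t Γ).ncard := by
  refine le_trans (Set.ncard_le_ncard (t := (fun (φ : E → Γ) (g : {g // g ≠ e}) => φ g) ''
    nzFlows s t Γ) ?_ (Set.toFinite _)) (Set.ncard_image_le (Set.toFinite _))
  rintro φ ⟨hφ, hφ0⟩
  let φ₀ : E → Γ := fun g => if h : g = e then 0 else φ ⟨g, h⟩
  let Φ : E → Γ := φ₀ + Pi.single e (-boundary s t φ₀ (s e))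
  have hΦ0 : ∀ g (h : g ≠ e), Φ g = φ ⟨g, h⟩ := fun g h => by simp [Φ, φ₀, h]
  have hΦ : boundary s t Φ = 0 := by
    have h1 : ∀ v, v ≠ t e → boundary s t Φ v = 0 := by
      intro v ht
      simp only [Φ, map_add, boundary_single, Pi.add_apply, Pi.sub_apply]
      by_cases hs : v = s e
      · subst hs; simp [he]
      · have h := congrFun hφ ⟨v, ht⟩
        rw [boundary_apply] at h
        simp only [contract_eq_iff he hs ht] at h
        have h2 : boundary s t φ₀ v = 0 := by
          refine Eq.trans ?_ (h.trans (Pi.zero_apply _))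
          rw [boundary_apply, Fintype.sum_eq_add_sum_subtype_ne _ e,
            show φ₀ e = 0 by simp [φ₀], ite_self, ite_self, sub_zero, zero_add]
          exact Finset.sum_congr rfl fun g _ => by
            rw [show φ₀ g = φ g by simp [φ₀, g.2]]
        simp [h2, hs, ht]
    have h2 : ∑ v, boundary s t Φ v = 0 := by rw [sum_boundary]; simp
    rw [Fintype.sum_eq_single (t e) h1] at h2
    ext v
    by_cases hv : v = t e
    · rw [hv, h2]; rfl
    · exact h1 v hv
  refine ⟨Φ, ⟨hΦ, fun g hg => ?_⟩, funext fun g => hΦ0 g g.2⟩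
  by_cases hge : g = e
  · subst hge
    have h := sum_boundary s t Φ X
    rw [hΦ, Finset.sum_congr rfl fun v _ => Pi.zero_apply v, Finset.sum_const_zero,
      Fintype.sum_eq_single f] at h
    · have hf : f ∈ cut s t X := by simp [hX]
      rw [mem_cut] at hf
      refine hφ0 ⟨f, hef⟩ ?_
      rw [← hΦ0 f hef]
      by_cases a : s f ∈ X <;> by_cases b : t f ∈ X
      · exact absurd (iff_of_true a b) hf
      · simpa [a, b] using h.symm
      · simpa [a, b] using h.symm
      · exact absurd (iff_of_false a b) hf
    · intro g' hg'
      by_cases hge : g' = g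
      · simp [hge, hg]
      · have : g' ∉ cut s t X := by simp [hX, hge, hg']
        rw [mem_cut, not_not] at this
        simp [this]
  · exact hφ0 ⟨g, hge⟩ (by rw [← hΦ0 g hge, hg])

/-- Contracting an edge of a `2`-edge cut changes neither the difference of the numbers of
edges and vertices nor `2`-edge-connectivity, which reduces the bound to `3`-edge-connected
graphs. -/
theorem EdgeConnected.two_rpow_le {V : Type*} {E : Type*} [Fintype V] [Fintype E] [DecidableEq V]
    {s t : E → V} (hG : EdgeConnected s t 2) :
    (2 : ℝ) ^ (2 * ((Fintype.card E : ℝ) - Fintype.card V) / 9) ≤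
      (nzFlows s t (ZMod 2 × ZMod 3)).ncard := by
  classical
  induction hn : Fintype.card V generalizing V E with
  | zero =>
    have := Fintype.card_eq_zero_iff.1 hn
    have h3 : EdgeConnected s t 3 := fun X hX => isEmptyElim hX.choose
    simpa only [hn] using h3.two_rpow_le_of_three
  | succ n ih =>
    by_cases h3 : EdgeConnected s t 3
    · simpa only [hn] using h3.two_rpow_le_of_three
    unfold EdgeConnected at h3
    push Not at h3
    obtain ⟨X, hX, hX', hlt⟩ := h3
    have h2 := hG X hX hX'
    obtain ⟨e, f, hef, hcut⟩ := Finset.card_eq_two.1 (show (cut s t X).card = 2 by omega)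
    have he : s e ≠ t e := by
      intro h
      have : e ∈ cut s t X := by simp [hcut]
      simp [mem_cut, h] at this
    have hV : Fintype.card {x // x ≠ t e} = n := by
      rw [Fintype.card_subtype_compl, Fintype.card_subtype_eq, hn]; rfl
    have hE : Fintype.card E = Fintype.card {g // g ≠ e} + 1 := by
      have : 0 < Fintype.card E := Fintype.card_pos_iff.2 ⟨e⟩
      rw [Fintype.card_subtype_compl, Fintype.card_subtype_eq]; omega
    have h := ih (hG.contract he) hV
    rw [hE]
    push_cast
    rw [add_sub_add_right_eq_sub]
    refine h.trans ?_
    exact_mod_cast ncard_nzFlows_contract_le he hef.symm hcut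

end FlowCount

/-! ### Flows of `Graph`s with an orientation -/

namespace FlowCount

variable {V E : Type*} [Fintype E] [DecidableEq V] {s t : E → V} {Γ : Type*} [AddCommGroup Γ]

lemma nzFlows_comp_injective {W : Type*} [DecidableEq W] {j : V → W} (hj : Function.Injective j) :
    nzFlows (fun e => j (s e)) (fun e => j (t e)) Γ = nzFlows s t Γ := by
  ext φ
  refine and_congr_left fun _ => ⟨fun h => ?_, fun h => ?_⟩
  · ext v
    refine Eq.trans ?_ (congrFun h (j v))
    simp only [boundary_apply, hj.eq_iff]
  · ext w
    by_cases hw : ∃ v, j v = w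
    · obtain ⟨v, rfl⟩ := hw
      refine Eq.trans ?_ (congrFun h v)
      simp only [boundary_apply, hj.eq_iff]
    · have h' : ∀ v, j v ≠ w := fun v hv => hw ⟨v, hv⟩
      simp [boundary_apply, h']

lemma ncard_nzFlows_comp_equiv {E' : Type*} [Fintype E'] (σ : E' ≃ E) :
    (nzFlows (s ∘ σ) (t ∘ σ) Γ).ncard = (nzFlows s t Γ).ncard := by
  have hσ : Function.Injective fun φ : E → Γ => φ ∘ σ := σ.surjective.injective_comp_right
  rw [← Set.ncard_image_of_injective _ hσ]
  congr 1
  have hb : ∀ φ : E → Γ, boundary (s ∘ σ) (t ∘ σ) (φ ∘ σ) = boundary s t φ := fun φ => by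
    ext v
    exact σ.sum_comp fun e => (if s e = v then φ e else 0) - (if t e = v then φ e else 0)
  ext ψ
  constructor
  · rintro ⟨h, h0⟩
    have hψ : (ψ ∘ σ.symm) ∘ σ = ψ := by ext; simp
    exact ⟨ψ ∘ σ.symm, ⟨by rw [← hb, hψ, h], fun e => h0 _⟩, hψ⟩
  · rintro ⟨φ, ⟨h, h0⟩, rfl⟩
    exact ⟨by rw [hb, h], fun e => h0 _⟩

/-- Reversing edges does not change the number of nowhere-zero flows: change the sign of the flow
on the reversed edges. -/
lemma ncard_nzFlows_le_of_reverse [Finite Γ] {s' t' : E → V}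
    (h : ∀ e, (s' e = s e ∧ t' e = t e) ∨ (s' e = t e ∧ t' e = s e)) :
    (nzFlows s t Γ).ncard ≤ (nzFlows s' t' Γ).ncard := by
  classical
  let F : (E → Γ) → E → Γ := fun φ e => if s' e = s e ∧ t' e = t e then φ e else -φ e
  have hF : Function.Injective F := by
    intro φ φ' h'
    ext e
    have := congrFun h' e
    simp only [F] at this
    split_ifs at this
    · exact this
    · exact neg_injective this
  rw [← Set.ncard_image_of_injective _ hF]
  refine Set.ncard_le_ncard ?_ (Set.toFinite _)
  rintro _ ⟨φ, ⟨hφ, hφ0⟩, rfl⟩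
  refine ⟨?_, fun e => ?_⟩
  · rw [← hφ]
    ext v
    refine Finset.sum_congr rfl fun e _ => ?_
    simp only [F]
    by_cases he : s' e = s e ∧ t' e = t e
    · simp only [he, and_self, if_true]
    · obtain ⟨h1, h2⟩ := (h e).resolve_left he
      rw [if_neg he, h1, h2]
      split_ifs <;> simp
  · simp only [F]
    split_ifs
    · exact hφ0 e
    · exact neg_ne_zero.2 (hφ0 e)

lemma ncard_nzFlows_eq_of_reverse [Finite Γ] {s' t' : E → V}
    (h : ∀ e, (s' e = s e ∧ t' e = t e) ∨ (s' e = t e ∧ t' e = s e)) :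
    (nzFlows s t Γ).ncard = (nzFlows s' t' Γ).ncard :=
  le_antisymm (ncard_nzFlows_le_of_reverse h) (ncard_nzFlows_le_of_reverse fun e =>
    (h e).imp (fun h => ⟨h.1.symm, h.2.symm⟩) fun h => ⟨h.2.symm, h.1.symm⟩)

end FlowCount

namespace Graph

open FlowCount

variable {α β : Type*} {G : Graph α β} (D : G.Orientation)

lemma Orientation.nowhereZeroFlows_eq [Fintype E(G)] [DecidableEq α]
    (Γ : Type*) [AddCommGroup Γ] : D.nowhereZeroFlows Γ = nzFlows D.tail D.head Γ := by
  ext φ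
  refine and_congr_left fun _ => ?_
  have h : ∀ v, boundary D.tail D.head φ v =
      (∑ᶠ e ∈ D.outEdges v, φ e) - ∑ᶠ e ∈ D.inEdges v, φ e := by
    intro v
    rw [finsum_mem_def, finsum_mem_def, finsum_eq_sum_of_fintype, finsum_eq_sum_of_fintype,
      boundary_apply, Finset.sum_sub_distrib]
    simp only [Set.indicator_apply, Orientation.outEdges, Orientation.inEdges, Set.mem_ofPred_eq]
  refine ⟨fun hφ => ?_, fun hφ v _ => sub_eq_zero.1 ((h v).symm.trans (congrFun hφ v))⟩
  ext v
  by_cases hv : v ∈ V(G)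
  · rw [h, hφ v hv, sub_self]; rfl
  · have h1 : ∀ e, D.tail e ≠ v := fun e he => hv (he ▸ (D.isLink e).left_mem)
    have h2 : ∀ e, D.head e ≠ v := fun e he => hv (he ▸ (D.isLink e).right_mem)
    simp [boundary_apply, h1, h2]

lemma IsEdgeConnected.edgeConnected [Fintype V(G)] [Fintype E(G)] [DecidableEq V(G)] {k : ℕ}
    (hG : G.IsEdgeConnected k) :
    EdgeConnected (fun e => (⟨D.tail e, (D.isLink e).left_mem⟩ : V(G)))
      (fun e => ⟨D.head e, (D.isLink e).right_mem⟩) k := by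
  intro X hX hX'
  have h := hG (Subtype.val '' (X : Set V(G))) (by rintro _ ⟨x, -, rfl⟩; exact x.2)
    (by simpa using hX) (fun h => hX' (by
      ext x
      have hx : (x : α) ∈ Subtype.val '' (X : Set V(G)) := by rw [h]; exact x.2
      simpa using hx))
  have hsub : G.edgeCut (Subtype.val '' (X : Set V(G))) ⊆ Subtype.val ''
      (cut (fun e => (⟨D.tail e, (D.isLink e).left_mem⟩ : V(G)))
        (fun e => ⟨D.head e, (D.isLink e).right_mem⟩) X : Set E(G)) := by
    rintro e ⟨x, y, hxy, hx, hy⟩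
    refine ⟨⟨e, hxy.edge_mem⟩, ?_, rfl⟩
    rw [Finset.mem_coe, mem_cut]
    obtain ⟨x, hx, rfl⟩ := hx
    have hy' : (⟨y, hxy.right_mem⟩ : V(G)) ∉ X := fun h => hy ⟨_, h, rfl⟩
    rw [Finset.mem_coe] at hx
    rcases (D.isLink ⟨e, hxy.edge_mem⟩).eq_and_eq_or_eq_and_eq hxy with h | h <;>
      simp only [h.1, h.2, hx, hy'] <;> simp
  have h' := h.trans ((Set.encard_le_encard hsub).trans (Set.encard_image_le _ _))
  rw [Set.encard_coe_eq_coe_finsetCard] at h'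
  exact_mod_cast h'

theorem two_rpow_le_ncard_nowhereZeroFlows (hV : V(G).Finite) (hE : E(G).Finite)
    (hG : G.IsEdgeConnected 2) :
    (2 : ℝ) ^ (2 * ((E(G).ncard : ℝ) - V(G).ncard) / 9) ≤
      (D.nowhereZeroFlows (ZMod 2 × ZMod 3)).ncard := by
  classical
  have := hV.fintype
  have := hE.fintype
  have h := (hG.edgeConnected D).two_rpow_le
  rw [← nzFlows_comp_injective Subtype.val_injective] at h
  rw [D.nowhereZeroFlows_eq, ← Nat.card_coe_set_eq, ← Nat.card_coe_set_eq,
    Nat.card_eq_fintype_card, Nat.card_eq_fintype_card]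
  exact h

end Graph

/-! ### A cycle with some edges doubled -/

namespace FlowCount

section CycleFlows

variable {n k : ℕ}

/-- The tails of the edges of the cycle on `Fin (n + 1)` whose first `k` edges are doubled: the
edges `Sum.inl i` form the cycle, and `Sum.inr j` is parallel to the edge that leaves `j`. The head
of an edge with tail `v` is `v + 1`. -/
def cycleTail (h : k ≤ n) : Fin (n + 1) ⊕ Fin k → Fin (n + 1) :=
  Sum.elim id (Fin.castLE (h.trans n.le_succ))

variable {Γ : Type*} [AddCommGroup Γ] (h : k ≤ n)

/-- The total value of `b` on the second edges with tail `v`; at most one such edge exists. -/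
def extraValue (b : Fin k → Γ) (v : Fin (n + 1)) : Γ :=
  ∑ j, if Fin.castLE (h.trans n.le_succ) j = v then b j else 0

lemma extraValue_castLE (b : Fin k → Γ) (j : Fin k) :
    extraValue h b (Fin.castLE (h.trans n.le_succ) j) = b j := by
  simp [extraValue]

lemma extraValue_of_le (b : Fin k → Γ) {v : Fin (n + 1)} (hv : k ≤ v) :
    extraValue h b v = 0 := by
  refine Finset.sum_eq_zero fun j _ => if_neg ?_
  rintro rfl
  have := j.2
  simp only [Fin.val_castLE] at hv
  omega

lemma boundary_cycle (a : Fin (n + 1) → Γ) (b : Fin k → Γ) (v : Fin (n + 1)) :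
    boundary (cycleTail h) (fun e => cycleTail h e + 1) (Sum.elim a b) v =
      (a v + extraValue h b v) - (a (v - 1) + extraValue h b (v - 1)) := by
  have ha : ∀ w, (∑ i, if cycleTail h (Sum.inl i) = w then a i else 0) = a w := fun w =>
    (Fintype.sum_eq_single w fun _ hx => if_neg hx).trans (if_pos rfl)
  rw [boundary_apply]
  simp only [Finset.sum_sub_distrib, Fintype.sum_sum_type, Sum.elim_inl, Sum.elim_inr,
    ← eq_sub_iff_add_eq, ha]
  rfl

lemma boundary_cycle_eq_zero_iff (a : Fin (n + 1) → Γ) (b : Fin k → Γ) :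
    boundary (cycleTail h) (fun e => cycleTail h e + 1) (Sum.elim a b) = 0 ↔
      ∃ c, ∀ v, a v + extraValue h b v = c := by
  constructor
  · intro hb
    refine ⟨a 0 + extraValue h b 0, fun v => ?_⟩
    induction v using Fin.induction with
    | zero => rfl
    | succ i ih =>
      rw [← ih, ← sub_eq_zero, ← Fin.coeSucc_eq_succ]
      have := boundary_cycle h a b (i.castSucc + 1)
      rw [hb, add_sub_cancel_right] at this
      exact this.symm
  · rintro ⟨c, hc⟩
    ext v
    rw [boundary_cycle, hc, hc, sub_self]; rfl

/-- A nowhere-zero flow sends a nonzero value `c` around the cycle, as some edge is not doubled. On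
a pair of parallel edges it takes the values `c - x` and `x` with `x ∉ {0, c}`. -/
lemma ncard_nzFlows_cycle :
    (nzFlows (cycleTail h) (fun e => cycleTail h e + 1) (ZMod 2 × ZMod 3)).ncard =
      5 * 2 ^ (2 * k) := by
  let F : (Σ c : {c : ZMod 2 × ZMod 3 // c ≠ 0}, Fin k → {x // x ≠ 0 ∧ x ≠ c.1}) →
      Fin (n + 1) ⊕ Fin k → ZMod 2 × ZMod 3 := fun p =>
    Sum.elim (fun v => p.1.1 - extraValue h (fun j => (p.2 j).1) v) fun j => (p.2 j).1
  have hF : Function.Injective F := by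
    rintro ⟨⟨c, hc⟩, b⟩ ⟨⟨c', hc'⟩, b'⟩ hp
    have h1 : c = c' := by
      have := congrFun hp (Sum.inl (Fin.last n))
      simpa [F, extraValue_of_le h _ (show k ≤ (Fin.last n : ℕ) from h)] using this
    subst h1
    have h2 : b = b' := by
      ext j : 2
      exact congrFun hp (Sum.inr j)
    rw [h2]
  have hrange : nzFlows (cycleTail h) (fun e => cycleTail h e + 1) (ZMod 2 × ZMod 3) =
      Set.range F := by
    ext φ
    constructor
    · rintro ⟨hφ, hφ0⟩
      obtain ⟨a, b, rfl⟩ : ∃ a b, φ = Sum.elim a b := ⟨_, _, (Sum.elim_comp_inl_inr φ).symm⟩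
      obtain ⟨c, hc⟩ := (boundary_cycle_eq_zero_iff h a b).1 hφ
      have hc0 : c ≠ 0 := by
        rw [← hc (Fin.last n), extraValue_of_le h _ (show k ≤ (Fin.last n : ℕ) from h), add_zero]
        exact hφ0 (Sum.inl _)
      refine ⟨⟨⟨c, hc0⟩, fun j => ⟨b j, hφ0 (Sum.inr j), fun hb => ?_⟩⟩, ?_⟩
      · have h1 := hc (Fin.castLE (h.trans n.le_succ) j)
        rw [extraValue_castLE, hb, add_eq_right] at h1
        exact hφ0 (Sum.inl _) h1
      · ext1 e
        rcases e with v | j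
        · exact sub_eq_of_eq_add (hc v).symm
        · rfl
    · rintro ⟨⟨⟨c, hc⟩, b⟩, rfl⟩
      refine ⟨(boundary_cycle_eq_zero_iff h _ _).2 ⟨c, fun v => sub_add_cancel _ _⟩, fun e => ?_⟩
      rcases e with v | j
      · change c - extraValue h (fun j => (b j).1) v ≠ 0
        rcases le_or_gt k v with hv | hv
        · rwa [extraValue_of_le h _ hv, sub_zero]
        · have := extraValue_castLE h (fun j => (b j).1) ⟨v, hv⟩
          rw [show Fin.castLE (h.trans n.le_succ) ⟨v, hv⟩ = v from rfl] at this
          rw [this, sub_ne_zero]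
          exact (b ⟨v, hv⟩).2.2.symm
      · exact (b j).2.1
  have hcard : ∀ c : {c : ZMod 2 × ZMod 3 // c ≠ 0},
      Fintype.card {x : ZMod 2 × ZMod 3 // x ≠ 0 ∧ x ≠ c.1} = 4 := by decide
  have hcard' : Fintype.card {c : ZMod 2 × ZMod 3 // c ≠ 0} = 5 := by decide
  rw [hrange, Set.ncard_range_of_injective hF, Nat.card_eq_fintype_card, Fintype.card_sigma]
  simp only [Fintype.card_fun, Fintype.card_fin, hcard]
  rw [Finset.sum_const, Finset.card_univ, hcard', smul_eq_mul, pow_mul]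
  norm_num

end CycleFlows

/-- The cycle on `Fin (n + 1)` with its first `k` edges doubled. -/
def cycleGraph (n k : ℕ) (h : k ≤ n) : Graph (Fin (n + 1)) (Fin (n + 1 + k)) where
  vertexSet := Set.univ
  edgeSet := Set.univ
  IsLink e x y := (x = cycleTail h (finSumFinEquiv.symm e) ∧
      y = cycleTail h (finSumFinEquiv.symm e) + 1) ∨
    (y = cycleTail h (finSumFinEquiv.symm e) ∧ x = cycleTail h (finSumFinEquiv.symm e) + 1)
  isLink_symm _ _ := ⟨fun _ _ => Or.symm⟩
  eq_or_eq_of_isLink_of_isLink := by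
    rintro e x y v w (⟨rfl, -⟩ | ⟨-, rfl⟩) (⟨rfl, rfl⟩ | ⟨rfl, rfl⟩) <;> simp
  edge_mem_iff_exists_isLink e := ⟨fun _ => ⟨_, _, Or.inl ⟨rfl, rfl⟩⟩, fun _ => Set.mem_univ e⟩
  left_mem_of_isLink _ _ _ _ := Set.mem_univ _

lemma exists_mem_add_one_notMem {n : ℕ} {X : Set (Fin (n + 1))} (hX : X.Nonempty)
    (hX' : X ≠ Set.univ) : ∃ i ∈ X, i + 1 ∉ X := by
  by_contra! hcon
  obtain ⟨x, hx⟩ := hX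
  have h : ∀ d : Fin (n + 1), x + d ∈ X := by
    intro d
    induction d using Fin.induction with
    | zero => simpa using hx
    | succ d ih =>
      rw [← Fin.coeSucc_eq_succ, ← add_assoc]
      exact hcon _ ih
  refine hX' (Set.eq_univ_of_forall fun y => ?_)
  have := h (y - x)
  rwa [add_sub_cancel] at this

lemma isEdgeConnected_cycleGraph {n k : ℕ} (h : k ≤ n) :
    (cycleGraph n k h).IsEdgeConnected 2 := by
  intro X _ hX hX'
  obtain ⟨i, hi, hi'⟩ := exists_mem_add_one_notMem hX hX'
  obtain ⟨j, hj, hj'⟩ := exists_mem_add_one_notMem (X := Xᶜ) (Set.nonempty_compl.2 hX')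
    (by rwa [ne_eq, Set.compl_univ_iff, ← ne_eq, ← Set.nonempty_iff_ne_empty])
  have hij : i ≠ j := by rintro rfl; exact hj hi
  have hinj : finSumFinEquiv (Sum.inl i : Fin (n + 1) ⊕ Fin k) ≠ finSumFinEquiv (Sum.inl j) :=
    fun h => hij (Sum.inl_injective (finSumFinEquiv.injective h))
  have h2 := Set.encard_pair hinj
  refine (le_of_eq ?_).trans (Set.encard_le_encard (s := {finSumFinEquiv (Sum.inl i),
    finSumFinEquiv (Sum.inl j)}) ?_)
  · rw [h2]; rfl
  · rintro e (rfl | rfl)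
    · exact ⟨i, i + 1, Or.inl (by simp [cycleTail]), hi, hi'⟩
    · exact ⟨j + 1, j, Or.inr (by simp [cycleTail]), not_not.1 hj', hj⟩

lemma ncard_nowhereZeroFlows_cycleGraph {n k : ℕ} (h : k ≤ n)
    (D : (cycleGraph n k h).Orientation) :
    (D.nowhereZeroFlows (ZMod 2 × ZMod 3)).ncard = 5 * 2 ^ (2 * k) := by
  have : Fintype (cycleGraph n k h).edgeSet := Fintype.ofFinite _
  let σ : Fin (n + 1) ⊕ Fin k ≃ (cycleGraph n k h).edgeSet :=
    finSumFinEquiv.trans (Equiv.Set.univ _).symm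
  rw [D.nowhereZeroFlows_eq, ← ncard_nzFlows_comp_equiv σ, ← ncard_nzFlows_cycle h]
  refine ncard_nzFlows_eq_of_reverse fun e => ?_
  have hD : D.tail (σ e) = _ ∧ D.head (σ e) = _ ∨ D.head (σ e) = _ ∧ D.tail (σ e) = _ :=
    D.isLink (σ e)
  have hσ : finSumFinEquiv.symm (σ e : Fin (n + 1 + k)) = e := finSumFinEquiv.symm_apply_apply e
  rw [hσ] at hD
  simp only [Function.comp_apply]
  rcases hD with ⟨h1, h2⟩ | ⟨h1, h2⟩
  · exact Or.inl ⟨h1.symm, h2.symm⟩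
  · exact Or.inr ⟨h1.symm, h2.symm⟩

end FlowCount

theorem mainTheorem2 :
    (∀ {α : Type*} {β : Type*} (G : Graph α β) (D : G.Orientation) (n m : ℕ),
      G.vertexSet.Finite → G.edgeSet.Finite →
      G.vertexSet.ncard = n → G.edgeSet.ncard = m →
      G.IsEdgeConnected 2 →
      (2 : ℝ) ^ (2 * ((m : ℝ) - (n : ℝ)) / 9) ≤
        ((D.nowhereZeroFlows (ZMod 2 × ZMod 3)).ncard : ℝ)) ∧
    (∀ n m : ℕ, n ≤ m → m < 2 * n →
      ∃ G : Graph (Fin n) (Fin m),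
        G.vertexSet.ncard = n ∧ G.edgeSet.ncard = m ∧ G.IsEdgeConnected 2 ∧
        ∀ D : G.Orientation,
          (D.nowhereZeroFlows (ZMod 2 × ZMod 3)).ncard = 5 * 2 ^ (2 * (m - n))) := by
  refine ⟨fun G D n m hV hE hn hm hG => ?_, fun n m hnm hmn => ?_⟩
  · subst hn hm
    exact Graph.two_rpow_le_ncard_nowhereZeroFlows D hV hE hG
  · obtain ⟨k, rfl⟩ := Nat.exists_eq_add_of_le hnm
    obtain ⟨n, rfl⟩ := Nat.exists_eq_succ_of_ne_zero (show n ≠ 0 by omega)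
    have hk : k ≤ n := by omega
    refine ⟨FlowCount.cycleGraph n k hk, ?_, ?_, FlowCount.isEdgeConnected_cycleGraph hk,
      fun D => ?_⟩
    · exact (Set.ncard_univ _).trans (Nat.card_fin _)
    · exact (Set.ncard_univ _).trans (Nat.card_fin _)
    · rw [Nat.add_sub_cancel_left]
      exact FlowCount.ncard_nowhereZeroFlows_cycleGraph hk D
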